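/- Let $n\ge 1$ cars enter, one after the other, a one-way street with spots $1,\dots,n$. Their preferences $\alpha=(a_1,\dots,a_n)$ are uniformly distributed on $[n]^n$, where $[n]=\{1,\dots,n\}$. Fix $p\in[0,1]$. Each car goes to its preferred spot and parks there if the spot is free. If the spot is occupied, the driver tosses a coin that lands on heads with probability $p$, all coin tosses being independent of each other and of $\alpha$: on heads the car drives forward and parks in the first free spot after its preferred one, on tails it drives backward and parks in the closest free spot before its preferred one; if there is no such free spot, it leaves the street without parking. Write $\alpha\in\mathrm{PF}_n$ for the event that all $n$ cars park, let $Q_{n,p}(j)=\mathrm{P}(a_n=j\mid\alpha\in\mathrm{PF}_n)$ for $j\in[n]$, let $\mathrm{Unif}_n(j)=1/n$ be the uniform distribution on $[n]$, and let $\|P-R\|_{\mathrm{TV}}=\frac12\sum_{j=1}^n|P(j)-R(j)|$ be the total variation distance. Theorem. For every fixed $p\in[0,1]$ with $p\ne\frac12$, $$\|Q_{n,p}-\mathrm{Unif}_n\|_{\mathrm{TV}}=\Theta\!\left(\frac1{\sqrt n}\right)\qquad(n\to\infty),$$ where the implied constants may depend on $p$. -/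

import Mathlib

open MeasureTheory ProbabilityTheory Asymptotics Filter

namespace Parking

/-- The spot taken by a car with preferred spot `a` when the set of occupied spots is `occ`
(the spots `1, …, n` are represented by `Fin n`, in this order). The car parks in `a` if `a` is
free. Otherwise it looks at its coin: on heads (`true`) it takes the first free spot after `a`,
on tails (`false`) the closest free spot before `a`. The value `none` means that there is no
such free spot and the car leaves the street. -/
def parkSpot {n : ℕ} (occ : Finset (Fin n)) (a : Fin n) (heads : Bool) : Option (Fin n) :=
  if a ∉ occ then some a
  else if heads then
    if h : (Finset.univ.filter fun k : Fin n => a < k ∧ k ∉ occ).Nonempty then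
      some ((Finset.univ.filter fun k : Fin n => a < k ∧ k ∉ occ).min' h)
    else none
  else
    if h : (Finset.univ.filter fun k : Fin n => k < a ∧ k ∉ occ).Nonempty then
      some ((Finset.univ.filter fun k : Fin n => k < a ∧ k ∉ occ).max' h)
    else none

/-- Cars, given in order of arrival by their preference and their coin, enter a street in which
the spots in `occ` are occupied. The result is the set of occupied spots at the end, or `none`
if some car was unable to park. -/
def parkCars {n : ℕ} : Finset (Fin n) → List (Fin n × Bool) → Option (Finset (Fin n))
  | occ, [] => some occ
  | occ, (a, heads) :: cars =>
      (parkSpot occ a heads).bind fun k => parkCars (insert k occ) cars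

/-- All `n` cars with preference vector `α` and coins `c` park on the empty street with `n`
spots. -/
def AllPark {n : ℕ} (α : Fin n → Fin n) (c : Fin n → Bool) : Prop :=
  (parkCars ∅ (List.ofFn fun i => (α i, c i))).isSome = true

/-- The law of preferences and coins: the preference vector is uniform on `[n]^n`, and,
independently of it, each car has its own independent coin with probability `p` of heads. The coin
of a car is used only when its preferred spot is occupied on arrival. -/
noncomputable def parkingMeasure (n : ℕ) (p : unitInterval) :
    Measure ((Fin n → Fin n) × (Fin n → Bool)) :=
  (uniformOn Set.univ).prod (Measure.pi fun _ => bernoulliMeasure true false p)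

/-- The last of `n` cars. -/
def lastCar (n : ℕ) [NeZero n] : Fin n := ⟨n - 1, Nat.sub_one_lt (NeZero.ne n)⟩

/-- `Q n p j` is the conditional probability that the last car prefers spot `j`, given that all
cars park. -/
noncomputable def Q (n : ℕ) [NeZero n] (p : unitInterval) (j : Fin n) : ℝ :=
  (cond (parkingMeasure n p) {ω | AllPark ω.1 ω.2}).real {ω | ω.1 (lastCar n) = j}

/-- The uniform distribution on the `n` spots. -/
noncomputable def unif (n : ℕ) (_j : Fin n) : ℝ := 1 / (n : ℝ)

/-- Total variation distance of two distributions on the `n` spots. -/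
noncomputable def tvDist {n : ℕ} (P R : Fin n → ℝ) : ℝ := (1 / 2) * ∑ j, |P j - R j|

end Parking

namespace Parking

theorem parkSpot_eq_some_iff {n : ℕ} (occ : Finset (Fin n)) (a k : Fin n) (b : Bool) :
    parkSpot occ a b = some k ↔ k ∉ occ ∧ (a = k ∨
      (b = true ∧ a < k ∧ ∀ l, a ≤ l → l < k → l ∈ occ) ∨
      (b = false ∧ k < a ∧ ∀ l, k < l → l ≤ a → l ∈ occ)) := by
  unfold parkSpot
  by_cases ha : a ∈ occ
  · cases b
    · simp only [ha, not_true_eq_false, if_false, Bool.false_eq_true]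
      split_ifs with h
      · rw [Option.some_inj]
        constructor
        · rintro rfl
          have h1 := Finset.max'_mem _ h
          simp only [Finset.mem_filter, Finset.mem_univ, true_and] at h1
          refine ⟨h1.2, Or.inr (Or.inr ⟨trivial, h1.1, fun l hl hla => ?_⟩)⟩
          by_contra hlo
          have hlt : l < a := lt_of_le_of_ne hla (fun e => hlo (e ▸ ha))
          exact absurd (Finset.le_max' _ l (by simp [hlt, hlo])) (not_le.2 hl)
        · rintro ⟨hk, rfl | h2 | h2⟩
          · exact absurd ha hk
          · simp at h2
          · refine le_antisymm (Finset.max'_le _ _ _ fun l hl => ?_)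
              (Finset.le_max' _ _ (by simp [hk, h2.2.1]))
            simp only [Finset.mem_filter, Finset.mem_univ, true_and] at hl
            by_contra hlk
            exact hl.2 (h2.2.2 l (not_le.1 hlk) hl.1.le)
      · simp only [false_iff]
        rintro ⟨hk, rfl | h2 | h2⟩
        · exact absurd ha hk
        · simp at h2
        · exact h ⟨k, by simp [hk, h2.2.1]⟩
    · simp only [ha, not_true_eq_false, if_false, if_true]
      split_ifs with h
      · rw [Option.some_inj]
        constructor
        · rintro rfl
          have h1 := Finset.min'_mem _ h
          simp only [Finset.mem_filter, Finset.mem_univ, true_and] at h1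
          refine ⟨h1.2, Or.inr (Or.inl ⟨trivial, h1.1, fun l hla hl => ?_⟩)⟩
          by_contra hlo
          have hlt : a < l := lt_of_le_of_ne hla (fun e => hlo (e ▸ ha))
          exact absurd (Finset.min'_le _ l (by simp [hlt, hlo])) (not_le.2 hl)
        · rintro ⟨hk, rfl | h2 | h2⟩
          · exact absurd ha hk
          · refine le_antisymm (Finset.min'_le _ _ (by simp [hk, h2.2.1]))
              (Finset.le_min' _ _ _ fun l hl => ?_)
            simp only [Finset.mem_filter, Finset.mem_univ, true_and] at hl
            by_contra hlk
            exact hl.2 (h2.2.2 l hl.1.le (not_le.1 hlk))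
          · simp at h2
      · simp only [false_iff]
        rintro ⟨hk, rfl | h2 | h2⟩
        · exact absurd ha hk
        · exact h ⟨k, by simp [hk, h2.2.1]⟩
        · simp at h2
  · simp only [ha, not_false_eq_true, if_true, Option.some_inj]
    constructor
    · rintro rfl
      exact ⟨ha, Or.inl rfl⟩
    · rintro ⟨-, h | h | h⟩
      · exact h
      · exact absurd (h.2.2 a le_rfl h.2.1) ha
      · exact absurd (h.2.2 a h.2.1 le_rfl) ha

theorem parkCars_append_singleton {n : ℕ} (l : List (Fin n × Bool)) (x : Fin n × Bool)
    (occ : Finset (Fin n)) :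
    parkCars occ (l ++ [x]) =
      (parkCars occ l).bind fun S => (parkSpot S x.1 x.2).map fun k => insert k S := by
  induction l generalizing occ with
  | nil =>
    simp only [List.nil_append, parkCars, Option.bind_some]
    cases parkSpot occ x.1 x.2 <;> rfl
  | cons y l ih =>
    simp only [List.cons_append, parkCars]
    cases parkSpot occ y.1 y.2 with
    | none => rfl
    | some k => simpa using ih _

theorem parkCars_append_singleton_eq_some_iff {n : ℕ} (l : List (Fin n × Bool))
    (x : Fin n × Bool) (occ T : Finset (Fin n)) :
    parkCars occ (l ++ [x]) = some T ↔ ∃ k ∈ T, parkCars occ l = some (T.erase k) ∧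
      parkSpot (T.erase k) x.1 x.2 = some k := by
  rw [parkCars_append_singleton]
  simp only [Option.bind_eq_some_iff, Option.map_eq_some_iff]
  constructor
  · rintro ⟨S, hS, k, hk, rfl⟩
    have hkS := ((parkSpot_eq_some_iff _ _ _ _).1 hk).1
    refine ⟨k, Finset.mem_insert_self _ _, ?_, ?_⟩ <;> rwa [Finset.erase_insert hkS]
  · rintro ⟨k, hk, h1, h2⟩
    exact ⟨_, h1, k, h2, Finset.insert_erase hk⟩

theorem card_of_parkCars_eq_some {n : ℕ} (l : List (Fin n × Bool)) (occ T : Finset (Fin n))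
    (h : parkCars occ l = some T) : T.card = occ.card + l.length := by
  induction l generalizing occ with
  | nil => simp_all [parkCars]
  | cons x l ih =>
    simp only [parkCars, Option.bind_eq_some_iff] at h
    obtain ⟨k, hk, h⟩ := h
    rw [ih _ h, Finset.card_insert_of_notMem ((parkSpot_eq_some_iff _ _ _ _).1 hk).1,
      List.length_cons]
    omega

theorem allPark_iff {n : ℕ} (α : Fin n → Fin n) (c : Fin n → Bool) :
    AllPark α c ↔ parkCars ∅ (List.ofFn fun i => (α i, c i)) = some Finset.univ := by
  unfold AllPark
  constructor
  · intro h
    obtain ⟨T, hT⟩ := Option.isSome_iff_exists.1 h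
    rw [hT, Option.some_inj, ← Finset.card_eq_iff_eq_univ,
      card_of_parkCars_eq_some _ _ _ hT]
    simp
  · intro h
    simp [h]

/-- The probability that a coin shows `b`. -/
def coinWeight (p : ℝ) (b : Bool) : ℝ := if b then p else 1 - p

/-- The probability that a car with preference `a` takes the spot `k` when `occ` is occupied. -/
def spotWeight {n : ℕ} (p : ℝ) (occ : Finset (Fin n)) (a k : Fin n) : ℝ :=
  ∑ b, coinWeight p b * if parkSpot occ a b = some k then 1 else 0

/-- The number of sequences of `m` cars that occupy exactly `T`, each weighted by the probability
of its coins. -/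
def outcomeWeight {n : ℕ} (p : ℝ) (m : ℕ) (T : Finset (Fin n)) : ℝ :=
  ∑ v : Fin m → Fin n × Bool, (∏ i, coinWeight p (v i).2) *
    if parkCars ∅ (List.ofFn v) = some T then 1 else 0

/-- As `outcomeWeight`, for sequences of `m + 1` cars whose last car prefers `j`. -/
def lastPrefWeight {n : ℕ} (p : ℝ) (m : ℕ) (T : Finset (Fin n)) (j : Fin n) : ℝ :=
  ∑ v : Fin (m + 1) → Fin n × Bool, (∏ i, coinWeight p (v i).2) *
    if parkCars ∅ (List.ofFn v) = some T ∧ (v (Fin.last m)).1 = j then 1 else 0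

theorem sum_lastPrefWeight {n : ℕ} (p : ℝ) (m : ℕ) (T : Finset (Fin n)) :
    ∑ j, lastPrefWeight p m T j = outcomeWeight p (m + 1) T := by
  unfold lastPrefWeight outcomeWeight
  rw [Finset.sum_comm]
  refine Finset.sum_congr rfl fun v _ => ?_
  rw [← Finset.mul_sum]
  congr 1
  simp_rw [ite_and]
  split_ifs <;> simp

theorem indicator_parkCars_concat {n : ℕ} (l : List (Fin n × Bool))
    (x : Fin n × Bool) (occ T : Finset (Fin n)) :
    (if parkCars occ (l ++ [x]) = some T then (1 : ℝ) else 0) =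
      ∑ k ∈ T, (if parkCars occ l = some (T.erase k) then 1 else 0) *
        (if parkSpot (T.erase k) x.1 x.2 = some k then 1 else 0) := by
  split_ifs with h
  · obtain ⟨k, hk, h1, h2⟩ := (parkCars_append_singleton_eq_some_iff _ _ _ _).1 h
    rw [Finset.sum_eq_single_of_mem k hk]
    · simp [h1, h2]
    · intro k' hk' hne
      rw [if_neg, zero_mul]
      rw [h1, Option.some_inj]
      intro e
      have : k' ∈ T.erase k := Finset.mem_erase.2 ⟨hne, hk'⟩
      rw [e] at this
      exact Finset.notMem_erase _ _ this
  · symm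
    refine Finset.sum_eq_zero fun k hk => ?_
    by_contra hne
    refine h ((parkCars_append_singleton_eq_some_iff _ _ _ _).2 ⟨k, hk, ?_, ?_⟩)
    · by_contra h1
      simp [h1] at hne
    · by_contra h1
      simp [h1] at hne

theorem lastPrefWeight_eq {n : ℕ} (p : ℝ) (m : ℕ) (T : Finset (Fin n)) (j : Fin n) :
    lastPrefWeight p m T j =
      ∑ k ∈ T, outcomeWeight p m (T.erase k) * spotWeight p (T.erase k) j k := by
  unfold lastPrefWeight
  rw [← (Fin.snocEquiv fun _ => Fin n × Bool).sum_comp, Fintype.sum_prod_type,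
    Fintype.sum_prod_type]
  have key : ∀ (a : Fin n) (b : Bool) (v : Fin m → Fin n × Bool),
      (∏ i, coinWeight p (((Fin.snocEquiv fun _ => Fin n × Bool) ((a, b), v)) i).2) *
        (if parkCars ∅ (List.ofFn ((Fin.snocEquiv fun _ => Fin n × Bool) ((a, b), v))) = some T ∧
          (((Fin.snocEquiv fun _ => Fin n × Bool) ((a, b), v)) (Fin.last m)).1 = j
          then (1 : ℝ) else 0) =
      if a = j then ∑ k ∈ T, ((∏ i, coinWeight p (v i).2) *
        if parkCars ∅ (List.ofFn v) = some (T.erase k) then 1 else 0) *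
        (coinWeight p b * if parkSpot (T.erase k) j b = some k then 1 else 0) else 0 := by
    intro a b v
    rw [Fin.prod_univ_castSucc, List.ofFn_succ', List.concat_eq_append]
    simp only [Fin.snocEquiv_apply, Fin.snoc_castSucc, Fin.snoc_last]
    by_cases haj : a = j
    · have h := indicator_parkCars_concat (List.ofFn v) (a, b) ∅ T
      subst haj
      simp only [and_true, if_true]
      rw [h, Finset.mul_sum]
      exact Finset.sum_congr rfl fun k _ => by ring
    · simp [haj]
  simp_rw [key]
  rw [Finset.sum_eq_single j (fun a _ ha => by simp [ha]) (by simp)]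
  simp only [if_true]
  unfold outcomeWeight spotWeight
  simp_rw [Finset.sum_mul_sum]
  rw [Finset.sum_comm]
  simp_rw [Finset.sum_comm (t := T)]

theorem outcomeWeight_succ {n : ℕ} (p : ℝ) (m : ℕ) (T : Finset (Fin n)) :
    outcomeWeight p (m + 1) T =
      ∑ k ∈ T, outcomeWeight p m (T.erase k) * ∑ j, spotWeight p (T.erase k) j k := by
  rw [← sum_lastPrefWeight]
  simp_rw [lastPrefWeight_eq, Finset.mul_sum]
  exact Finset.sum_comm

theorem outcomeWeight_zero {n : ℕ} (p : ℝ) :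
    outcomeWeight p 0 (∅ : Finset (Fin n)) = 1 := by
  simp [outcomeWeight, parkCars]

theorem spotWeight_union_left {n : ℕ} (p : ℝ) (A B : Finset (Fin n)) (x k : Fin n)
    (hA : ∀ a ∈ A, a < x) (hB : ∀ b ∈ B, x < b) (hk : k < x) (a : Fin n) :
    spotWeight p (A ∪ B) a k = spotWeight p A a k := by
  unfold spotWeight
  refine Finset.sum_congr rfl fun b _ => ?_
  congr 1
  refine if_congr ?_ rfl rfl
  have hx : x ∉ A ∪ B := by
    rw [Finset.mem_union]
    rintro (h | h)
    · exact lt_irrefl _ (hA x h)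
    · exact lt_irrefl _ (hB x h)
  have hlt : ∀ l, l < x → (l ∈ A ∪ B ↔ l ∈ A) := fun l hl => by
    rw [Finset.mem_union, or_iff_left]
    exact fun h => lt_asymm hl (hB l h)
  rw [parkSpot_eq_some_iff, parkSpot_eq_some_iff, hlt k hk]
  refine and_congr_right fun _ => or_congr_right (or_congr ?_ ?_)
  · refine and_congr_right fun _ => and_congr_right fun _ => forall_congr' fun l =>
      forall_congr' fun _ => forall_congr' fun h => hlt l (h.trans hk)
  · refine and_congr_right fun _ => and_congr_right fun hka => ⟨fun h l h1 h2 => ?_,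
      fun h l h1 h2 => Finset.mem_union_left _ (h l h1 h2)⟩
    have hax : a < x := by
      by_contra hxa
      exact hx (h x hk (not_lt.1 hxa))
    exact (hlt l (h2.trans_lt hax)).1 (h l h1 h2)

theorem spotWeight_union_right {n : ℕ} (p : ℝ) (A B : Finset (Fin n)) (x k : Fin n)
    (hA : ∀ a ∈ A, a < x) (hB : ∀ b ∈ B, x < b) (hk : x < k) (a : Fin n) :
    spotWeight p (A ∪ B) a k = spotWeight p B a k := by
  unfold spotWeight
  refine Finset.sum_congr rfl fun b _ => ?_
  congr 1
  refine if_congr ?_ rfl rfl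
  have hx : x ∉ A ∪ B := by
    rw [Finset.mem_union]
    rintro (h | h)
    · exact lt_irrefl _ (hA x h)
    · exact lt_irrefl _ (hB x h)
  have hlt : ∀ l, x < l → (l ∈ A ∪ B ↔ l ∈ B) := fun l hl => by
    rw [Finset.mem_union, or_iff_right]
    exact fun h => lt_asymm hl (hA l h)
  rw [parkSpot_eq_some_iff, parkSpot_eq_some_iff, hlt k hk]
  refine and_congr_right fun _ => or_congr_right (or_congr ?_ ?_)
  · refine and_congr_right fun _ => and_congr_right fun hka => ⟨fun h l h1 h2 => ?_,
      fun h l h1 h2 => Finset.mem_union_right _ (h l h1 h2)⟩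
    have hax : x < a := by
      by_contra hxa
      exact hx (h x (not_lt.1 hxa) hk)
    exact (hlt l (hax.trans_le h1)).1 (h l h1 h2)
  · refine and_congr_right fun _ => and_congr_right fun _ => forall_congr' fun l =>
      forall_congr' fun h => forall_congr' fun _ => hlt l (hk.trans h)

theorem outcomeWeight_union {n : ℕ} (p : ℝ) (x : Fin n) (s t : ℕ) (A B : Finset (Fin n))
    (hA : ∀ a ∈ A, a < x) (hB : ∀ b ∈ B, x < b) (hs : A.card = s) (ht : B.card = t) :
    outcomeWeight p (s + t) (A ∪ B) =
      (s + t).choose s * (outcomeWeight p s A * outcomeWeight p t B) := by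
  induction hm : s + t generalizing s t A B with
  | zero =>
    obtain ⟨rfl, rfl⟩ : s = 0 ∧ t = 0 := by omega
    rw [Finset.card_eq_zero] at hs ht
    simp [hs, ht, outcomeWeight_zero]
  | succ m ih =>
    have hdisj : Disjoint A B := Finset.disjoint_left.2 fun a h1 h2 => lt_asymm (hA a h1) (hB a h2)
    rw [outcomeWeight_succ, Finset.sum_union hdisj]
    have h1 : ∑ k ∈ A, outcomeWeight p m ((A ∪ B).erase k) *
        ∑ j, spotWeight p ((A ∪ B).erase k) j k =
        (if s = 0 then 0 else (m.choose (s - 1) : ℝ)) *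
          (outcomeWeight p s A * outcomeWeight p t B) := by
      rcases s with _ | s
      · rw [Finset.card_eq_zero] at hs
        simp [hs]
      · rw [outcomeWeight_succ, Finset.sum_mul, Finset.mul_sum]
        refine Finset.sum_congr rfl fun k hk => ?_
        have hkB : k ∉ B := Finset.disjoint_left.1 hdisj hk
        rw [Finset.erase_union_distrib, Finset.erase_eq_of_notMem hkB]
        have hA' : ∀ a ∈ A.erase k, a < x := fun a ha => hA a (Finset.mem_of_mem_erase ha)
        rw [ih s t _ _ hA' hB (by rw [Finset.card_erase_of_mem hk, hs]; rfl) ht (by omega)]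
        simp_rw [spotWeight_union_left p _ _ x k hA' hB (hA k hk)]
        simp only [Nat.add_eq_zero_iff, one_ne_zero, and_false, if_false, Nat.add_sub_cancel]
        ring
    have h2 : ∑ k ∈ B, outcomeWeight p m ((A ∪ B).erase k) *
        ∑ j, spotWeight p ((A ∪ B).erase k) j k =
        (if t = 0 then 0 else (m.choose s : ℝ)) *
          (outcomeWeight p s A * outcomeWeight p t B) := by
      rcases t with _ | t
      · rw [Finset.card_eq_zero] at ht
        simp [ht]
      · rw [outcomeWeight_succ, Finset.mul_sum, Finset.mul_sum]
        refine Finset.sum_congr rfl fun k hk => ?_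
        have hkA : k ∉ A := Finset.disjoint_right.1 hdisj hk
        rw [Finset.erase_union_distrib, Finset.erase_eq_of_notMem hkA]
        have hB' : ∀ b ∈ B.erase k, x < b := fun a ha => hB a (Finset.mem_of_mem_erase ha)
        rw [ih s t _ _ hA hB' hs (by rw [Finset.card_erase_of_mem hk, ht]; rfl) (by omega)]
        simp_rw [spotWeight_union_right p _ _ x k hA hB' (hB k hk)]
        simp only [Nat.add_eq_zero_iff, one_ne_zero, and_false, if_false]
        ring
    rw [h1, h2, ← add_mul]
    congr 1
    rcases s with _ | s
    · have : t ≠ 0 := by omega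
      simp [this]
    · rcases t with _ | t
      · obtain rfl : m = s := by omega
        simp
      · simp only [Nat.add_eq_zero_iff, one_ne_zero, and_false, if_false, Nat.add_sub_cancel]
        rw [Nat.choose_succ_succ]
        push_cast
        ring

theorem sum_range_neg_one_pow_mul_choose_mul_succ_pow (n : ℕ) :
    ∑ k ∈ Finset.range (n + 2),
      ((n + 1).choose k : ℝ) * (-1) ^ (n + 1 - k) * ((k : ℝ) + 1) ^ n = 0 := by
  have h := congrFun (fwdDiff_iter_pow_eq_zero_of_lt (R := ℝ) (Nat.lt_succ_self n)) 1
  rw [fwdDiff_iter_eq_sum_shift] at h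
  rw [Pi.zero_apply] at h
  rw [← h]
  refine Finset.sum_congr rfl fun k _ => ?_
  simp only [zsmul_eq_mul, nsmul_eq_mul, mul_one]
  push_cast
  ring

/-- The case `x = 1` of Abel's binomial theorem. -/
theorem abel_binomial (n : ℕ) (y : ℝ) :
    ∑ k ∈ Finset.range (n + 1), (n.choose k : ℝ) * ((k : ℝ) + 1) ^ (k - 1) *
      (y + (n - k : ℕ)) ^ (n - k) = (1 + y + n) ^ n := by
  induction n generalizing y with
  | zero => simp
  | succ n ih =>
    set P : ℝ → ℝ := fun y => ∑ k ∈ Finset.range (n + 2), ((n + 1).choose k : ℝ) *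
      ((k : ℝ) + 1) ^ (k - 1) * (y + (n + 1 - k : ℕ)) ^ (n + 1 - k) with hP
    have hderiv : ∀ y, HasDerivAt (fun y => P y - (1 + y + (n + 1 : ℕ)) ^ (n + 1)) 0 y := by
      intro y
      have h1 : HasDerivAt P (∑ k ∈ Finset.range (n + 2), ((n + 1).choose k : ℝ) *
          ((k : ℝ) + 1) ^ (k - 1) *
          ((n + 1 - k : ℕ) * (y + (n + 1 - k : ℕ)) ^ (n + 1 - k - 1) * 1)) y := by
        refine HasDerivAt.fun_sum fun k _ => HasDerivAt.const_mul _ ?_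
        exact ((hasDerivAt_id y).add_const _).pow _
      have h2 : HasDerivAt (fun y : ℝ => (1 + y + (n + 1 : ℕ)) ^ (n + 1))
          ((n + 1 : ℕ) * (1 + y + (n + 1 : ℕ)) ^ n * 1) y :=
        (((hasDerivAt_id y).const_add 1).add_const _).pow _
      refine (h1.sub h2).congr_deriv ?_
      rw [sub_eq_zero, Finset.sum_range_succ]
      have := ih (y + 1)
      rw [show 1 + y + ((n + 1 : ℕ) : ℝ) = 1 + (y + 1) + n by push_cast; ring, ← this]
      simp only [Nat.sub_self, Nat.cast_zero, zero_mul, mul_zero, add_zero, mul_one]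
      rw [Finset.mul_sum]
      refine Finset.sum_congr rfl fun k hk => ?_
      have hkn : k ≤ n := by simpa [Nat.lt_succ_iff] using hk
      have h4 : (n.choose k : ℝ) * (n + 1 : ℕ) = (n + 1).choose k * (n + 1 - k : ℕ) := by
        exact_mod_cast Nat.choose_mul_succ_eq n k
      have h5 : n + 1 - k = n - k + 1 := by omega
      rw [show n + 1 - k - 1 = n - k by omega,
        show y + 1 + ((n - k : ℕ) : ℝ) = y + (n + 1 - k : ℕ) by rw [h5]; push_cast; ring]
      linear_combination (-((k : ℝ) + 1) ^ (k - 1) * (y + (n + 1 - k : ℕ)) ^ (n - k)) * h4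
    have hconst := is_const_of_deriv_eq_zero (fun y => (hderiv y).differentiableAt)
      (fun y => (hderiv y).deriv) y (-(n + 2))
    have hzero : P (-(n + 2)) = 0 := by
      rw [hP, ← sum_range_neg_one_pow_mul_choose_mul_succ_pow n]
      refine Finset.sum_congr rfl fun k hk => ?_
      have hkn : k ≤ n + 1 := by simpa [Nat.lt_succ_iff] using hk
      rw [show (-((n : ℝ) + 2) + (n + 1 - k : ℕ)) = (-1) * (k + 1) by
        rw [Nat.cast_sub hkn]; push_cast; ring, mul_pow]
      rcases k with _ | k
      · simp
      · rw [show n = (k + 1 - 1) + (n + 1 - (k + 1)) by omega, pow_add _ (k + 1 - 1)]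
        rw [← show n = (k + 1 - 1) + (n + 1 - (k + 1)) by omega]
        ring
    simp only [hzero] at hconst
    rw [show (1 + -((n : ℝ) + 2) + (n + 1 : ℕ)) = 0 by push_cast; ring] at hconst
    simpa [sub_eq_zero] using hconst

/-- The symmetric form, at `x = y = 1`, of Abel's binomial theorem. -/
theorem abel_binomial_symm (n : ℕ) :
    ((n : ℝ) + 2) * ∑ k ∈ Finset.range (n + 1), (n.choose k : ℝ) * ((k : ℝ) + 1) ^ (k - 1) *
      (((n - k : ℕ) : ℝ) + 1) ^ (n - k - 1) = 2 * ((n : ℝ) + 2) ^ n := by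
  rcases n with _ | n
  · simp
  have h1 := abel_binomial (n + 1) 1
  have h2 := abel_binomial n 2
  have h3 : ∑ k ∈ Finset.range (n + 1 + 1), ((n + 1).choose k : ℝ) * ((k : ℝ) + 1) ^ (k - 1) *
      (((n + 1 - k : ℕ) : ℝ) + 1) ^ (n + 1 - k - 1) =
      (1 + 1 + (n + 1 : ℕ)) ^ (n + 1) - (n + 1) * (1 + 2 + (n : ℝ)) ^ n := by
    rw [← h1, ← h2, Finset.sum_range_succ, Finset.sum_range_succ _ (n + 1), add_sub_right_comm,
      Finset.mul_sum, ← Finset.sum_sub_distrib]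
    simp only [Nat.sub_self, Nat.zero_sub, pow_zero]
    congr 1
    refine Finset.sum_congr rfl fun k hk => ?_
    have hkn : k ≤ n := by simpa [Nat.lt_succ_iff] using hk
    have h4 : (n.choose k : ℝ) * (n + 1 : ℕ) = (n + 1).choose k * (n + 1 - k : ℕ) := by
      exact_mod_cast Nat.choose_mul_succ_eq n k
    have h5 : n + 1 - k = n - k + 1 := by omega
    rw [h5] at h4 ⊢
    rw [Nat.add_sub_cancel, pow_succ]
    push_cast at h4 ⊢
    rw [show (2 + ((n - k : ℕ) : ℝ)) = (n - k : ℕ) + 1 + 1 by ring,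
      show (1 + (((n - k : ℕ) : ℝ) + 1)) = (n - k : ℕ) + 1 + 1 by ring]
    linear_combination ((k : ℝ) + 1) ^ (k - 1) * ((n - k : ℕ) + 1 + 1 : ℝ) ^ (n - k) * h4
  rw [h3]
  push_cast
  ring

/-- The number `(m + 1) ^ (m - 1)` of classical parking functions of length `m`. -/
noncomputable def parkingCount (m : ℕ) : ℝ := ((m : ℝ) + 1) ^ (m - 1)

/-- The weight of the event that the first `m` of `m + 1` cars park and leave the spot with `k`
spots before it empty. -/
noncomputable def gapWeight (m k : ℕ) : ℝ :=
  (m.choose k : ℝ) * (parkingCount k * parkingCount (m - k))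

theorem gapWeight_reflect {m k : ℕ} (hk : k ≤ m) : gapWeight m (m - k) = gapWeight m k := by
  unfold gapWeight
  rw [Nat.choose_symm hk, Nat.sub_sub_self hk, mul_comm (parkingCount k)]

theorem sum_gapWeight (m : ℕ) :
    ((m : ℝ) + 2) * ∑ k ∈ Finset.range (m + 1), gapWeight m k = 2 * ((m : ℝ) + 2) ^ m := by
  rw [← abel_binomial_symm m]
  simp only [gapWeight, parkingCount, mul_assoc]

theorem sum_gapWeight_mul (p : ℝ) (m : ℕ) :
    ∑ k ∈ Finset.range (m + 1), gapWeight m k * (1 + p * k + (1 - p) * (m - k : ℕ)) =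
      parkingCount (m + 1) := by
  have h1 := Finset.sum_range_reflect
    (fun k => gapWeight m k * (1 + p * k + (1 - p) * (m - k : ℕ))) (m + 1)
  have h2 : ∑ k ∈ Finset.range (m + 1), gapWeight m k * (1 + p * k + (1 - p) * (m - k : ℕ)) +
      ∑ k ∈ Finset.range (m + 1), gapWeight m (m + 1 - 1 - k) *
        (1 + p * (m + 1 - 1 - k : ℕ) + (1 - p) * (m - (m + 1 - 1 - k) : ℕ)) =
      (m + 2) * ∑ k ∈ Finset.range (m + 1), gapWeight m k := by
    rw [← Finset.sum_add_distrib, Finset.mul_sum]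
    refine Finset.sum_congr rfl fun k hk => ?_
    have hkm : k ≤ m := by simpa [Nat.lt_succ_iff] using hk
    rw [Nat.add_sub_cancel, gapWeight_reflect hkm, Nat.sub_sub_self hkm, Nat.cast_sub hkm]
    ring
  rw [h1, sum_gapWeight] at h2
  unfold parkingCount
  rw [Nat.add_sub_cancel]
  push_cast
  rw [show (m : ℝ) + 1 + 1 = m + 2 by ring]
  linarith

theorem spotWeight_erase {n : ℕ} (p : ℝ) (I : Finset (Fin n))
    (hI : ∀ a ∈ I, ∀ b ∈ I, ∀ l, a ≤ l → l ≤ b → l ∈ I) {k : Fin n} (hk : k ∈ I) (j : Fin n) :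
    spotWeight p (I.erase k) j k =
      if j ∈ I then (if j = k then 1 else if j < k then p else 1 - p) else 0 := by
  unfold spotWeight coinWeight
  simp only [Fintype.sum_bool, parkSpot_eq_some_iff, Finset.notMem_erase, not_false_eq_true,
    true_and, Bool.true_eq_false, false_and, or_false, false_or, if_true, Bool.false_eq_true,
    if_false]
  rcases lt_trichotomy j k with hjk | hjk | hjk
  · have hiff : (∀ l, j ≤ l → l < k → l ∈ I.erase k) ↔ j ∈ I := by
      constructor
      · exact fun h => Finset.mem_of_mem_erase (h j le_rfl hjk)
      · exact fun h l h1 h2 => Finset.mem_erase.2 ⟨h2.ne, hI j h k hk l h1 h2.le⟩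
    simp only [hjk, hjk.ne, hjk.not_gt, hiff, true_and, false_and, if_true, if_false, false_or,
      or_false, mul_zero, add_zero, mul_ite, mul_one]
  · simp [hjk, hk]
  · have hiff : (∀ l, k < l → l ≤ j → l ∈ I.erase k) ↔ j ∈ I := by
      constructor
      · exact fun h => Finset.mem_of_mem_erase (h j hjk le_rfl)
      · exact fun h l h1 h2 => Finset.mem_erase.2 ⟨h1.ne', hI k hk j h l h1.le h2⟩
    simp only [hjk, hjk.ne', hjk.not_gt, hiff, true_and, false_and, if_false, false_or,
      or_false, mul_zero, zero_add, mul_ite, mul_one]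

/-- The `m` consecutive spots from `s` on. -/
def block (n s m : ℕ) : Finset (Fin n) :=
  Finset.univ.filter fun k => s ≤ (k : ℕ) ∧ (k : ℕ) < s + m

theorem mem_block {n s m : ℕ} {k : Fin n} : k ∈ block n s m ↔ s ≤ (k : ℕ) ∧ (k : ℕ) < s + m := by
  simp [block]

theorem sum_block {n s m : ℕ} (h : s + m ≤ n) (f : Fin n → ℝ) (g : ℕ → ℝ)
    (hfg : ∀ k : Fin n, k ∈ block n s m → f k = g (k - s)) :
    ∑ k ∈ block n s m, f k = ∑ i ∈ Finset.range m, g i := by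
  refine Finset.sum_bij (fun k _ => (k : ℕ) - s) ?_ ?_ ?_ hfg
  · intro k hk
    rw [mem_block] at hk
    rw [Finset.mem_range]
    omega
  · intro k hk l hl hkl
    rw [mem_block] at hk hl
    ext
    omega
  · intro i hi
    rw [Finset.mem_range] at hi
    refine ⟨⟨s + i, by omega⟩, ?_, ?_⟩
    · rw [mem_block]
      simp only
      omega
    · simp

theorem card_block {n s m : ℕ} (h : s + m ≤ n) : (block n s m).card = m := by
  have := sum_block h (fun _ => 1) (fun _ => 1) (fun _ _ => rfl)
  simpa using this

theorem block_ordConnected {n s m : ℕ} : ∀ a ∈ block n s m, ∀ b ∈ block n s m,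
    ∀ l, a ≤ l → l ≤ b → l ∈ block n s m := by
  intro a ha b hb l h1 h2
  rw [mem_block] at *
  rw [Fin.le_def] at h1 h2
  omega

theorem block_erase {n s m : ℕ} {k : Fin n} (hk : k ∈ block n s (m + 1)) :
    (block n s (m + 1)).erase k = block n s (k - s) ∪ block n (k + 1) (m - (k - s)) := by
  ext l
  rw [mem_block] at hk
  simp only [Finset.mem_erase, Finset.mem_union, mem_block, ne_eq, Fin.ext_iff]
  omega

theorem sum_range_ite_lt (p : ℝ) {m i : ℕ} (hi : i ≤ m) :
    ∑ j ∈ Finset.range (m + 1), (if j = i then (1 : ℝ) else if j < i then p else 1 - p) =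
      1 + p * i + (1 - p) * (m - i : ℕ) := by
  obtain ⟨d, rfl⟩ := Nat.exists_eq_add_of_le hi
  rw [show i + d + 1 = i + 1 + d by ring, Finset.sum_range_add, Finset.sum_range_succ]
  have h1 : ∑ j ∈ Finset.range i, (if j = i then (1 : ℝ) else if j < i then p else 1 - p) =
      ∑ j ∈ Finset.range i, p := Finset.sum_congr rfl fun j hj => by
    have := Finset.mem_range.1 hj
    simp [this, this.ne]
  have h2 : ∑ j ∈ Finset.range d, (if i + 1 + j = i then (1 : ℝ) else
      if i + 1 + j < i then p else 1 - p) = ∑ j ∈ Finset.range d, (1 - p) :=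
    Finset.sum_congr rfl fun j _ => by
      rw [if_neg (by omega), if_neg (by omega)]
  rw [h1, h2]
  simp
  ring

theorem sum_spotWeight_block {n s m : ℕ} (p : ℝ) (h : s + (m + 1) ≤ n) {k : Fin n}
    (hk : k ∈ block n s (m + 1)) :
    ∑ j, spotWeight p ((block n s (m + 1)).erase k) j k =
      1 + p * (k - s : ℕ) + (1 - p) * (m - (k - s) : ℕ) := by
  have hk' := mem_block.1 hk
  simp_rw [spotWeight_erase p _ block_ordConnected hk]
  rw [← Finset.sum_filter, Finset.filter_mem_eq_inter, Finset.univ_inter]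
  rw [sum_block h _ (fun i => if i = k - s then 1 else if i < k - s then p else 1 - p),
    sum_range_ite_lt p (by omega)]
  intro j hj
  rw [mem_block] at hj
  refine if_congr ?_ rfl (if_congr ?_ rfl rfl)
  · rw [Fin.ext_iff]
    omega
  · rw [Fin.lt_def]
    omega

theorem outcomeWeight_block_erase {n s m : ℕ} (p : ℝ) (h : s + (m + 1) ≤ n)
    (ih : ∀ l ≤ m, ∀ s, s + l ≤ n → outcomeWeight p l (block n s l) = parkingCount l)
    {k : Fin n} (hk : k ∈ block n s (m + 1)) :
    outcomeWeight p m ((block n s (m + 1)).erase k) = gapWeight m (k - s) := by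
  have hk' := mem_block.1 hk
  rw [block_erase hk]
  have := outcomeWeight_union p k (k - s) (m - (k - s)) (block n s (k - s))
    (block n (k + 1) (m - (k - s)))
    (fun a ha => by rw [mem_block] at ha; rw [Fin.lt_def]; omega)
    (fun a ha => by rw [mem_block] at ha; rw [Fin.lt_def]; omega)
    (card_block (by omega)) (card_block (by omega))
  rw [ih _ (by omega) _ (by omega), ih _ (by omega) _ (by omega),
    show (k - s : ℕ) + (m - (k - s)) = m by omega] at this
  exact this

theorem outcomeWeight_block {n : ℕ} (p : ℝ) (m s : ℕ) (h : s + m ≤ n) :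
    outcomeWeight p m (block n s m) = parkingCount m := by
  induction m using Nat.strong_induction_on generalizing s with
  | _ m ih =>
    rcases m with _ | m
    · rw [Finset.card_eq_zero.1 (card_block h), outcomeWeight_zero]
      simp [parkingCount]
    · rw [outcomeWeight_succ, ← sum_gapWeight_mul p m]
      refine sum_block h _ (fun k => gapWeight m k * (1 + p * k + (1 - p) * (m - k : ℕ)))
        fun k hk => ?_
      rw [sum_spotWeight_block p h hk, outcomeWeight_block_erase p h
        (fun l hl s hs => ih l (by omega) s hs) hk]

theorem block_eq_univ (n : ℕ) : block n 0 n = Finset.univ := by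
  ext k
  simp [mem_block]

theorem outcomeWeight_univ (n : ℕ) (p : ℝ) :
    outcomeWeight p n (Finset.univ : Finset (Fin n)) = parkingCount n := by
  rw [← block_eq_univ]
  exact outcomeWeight_block p n 0 (by omega)

theorem lastPrefWeight_univ (m : ℕ) (p : ℝ) (j : Fin (m + 1)) :
    lastPrefWeight p m Finset.univ j = ∑ k ∈ Finset.range (m + 1), gapWeight m k *
      (if (j : ℕ) = k then 1 else if (j : ℕ) < k then p else 1 - p) := by
  rw [lastPrefWeight_eq, ← block_eq_univ]
  refine sum_block (by omega) _ (fun k => gapWeight m k *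
      (if (j : ℕ) = k then 1 else if (j : ℕ) < k then p else 1 - p)) fun k hk => ?_
  rw [outcomeWeight_block_erase p (by omega)
    (fun l _ s hs => outcomeWeight_block p l s hs) hk, spotWeight_erase p _ block_ordConnected hk]
  simp [block_eq_univ, Fin.ext_iff]

theorem parkingMeasure_real_singleton (n : ℕ) (p : unitInterval)
    (ω : (Fin n → Fin n) × (Fin n → Bool)) :
    (parkingMeasure n p).real {ω} = ((n : ℝ) ^ n)⁻¹ * ∏ i, coinWeight p (ω.2 i) := by
  obtain ⟨α, c⟩ := ω
  unfold parkingMeasure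
  rw [← Set.singleton_prod_singleton, measureReal_prod_prod]
  congr 1
  · rw [measureReal_def, uniformOn_univ]
    simp
  · rw [measureReal_def, Measure.pi_singleton, ENNReal.toReal_prod]
    refine Finset.prod_congr rfl fun i _ => ?_
    classical
    rw [← measureReal_def, bernoulliMeasure_real_apply _ (measurableSet_singleton _)]
    simp only [Set.mem_singleton_iff]
    generalize c i = b
    cases b <;> simp [coinWeight]

theorem parkingMeasure_real_apply (n : ℕ) (p : unitInterval)
    (P : (Fin n → Fin n × Bool) → Prop) [DecidablePred P] :
    (parkingMeasure n p).real {ω | P fun i => (ω.1 i, ω.2 i)} = ((n : ℝ) ^ n)⁻¹ *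
      ∑ v : Fin n → Fin n × Bool, (∏ i, coinWeight p (v i).2) * if P v then 1 else 0 := by
  classical
  have : IsFiniteMeasure (parkingMeasure n p) := by
    unfold parkingMeasure
    infer_instance
  have h1 : {ω : (Fin n → Fin n) × (Fin n → Bool) | P fun i => (ω.1 i, ω.2 i)} =
      ((Finset.univ.filter fun ω : (Fin n → Fin n) × (Fin n → Bool) =>
        P fun i => (ω.1 i, ω.2 i) : Finset _) : Set _) := by
    ext ω
    simp
  rw [h1, ← sum_measureReal_singleton, Finset.sum_filter, Finset.mul_sum,
    ← (Equiv.arrowProdEquivProdArrow (Fin n) (fun _ => Fin n) (fun _ => Bool)).symm.sum_comp]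
  refine Finset.sum_congr rfl fun ω _ => ?_
  rw [parkingMeasure_real_singleton]
  have : (Equiv.arrowProdEquivProdArrow (Fin n) (fun _ => Fin n) (fun _ => Bool)).symm ω =
    fun i => (ω.1 i, ω.2 i) := rfl
  rw [this]
  split_ifs <;> simp

theorem parkingMeasure_real_allPark (n : ℕ) (p : unitInterval) :
    (parkingMeasure n p).real {ω | AllPark ω.1 ω.2} =
      ((n : ℝ) ^ n)⁻¹ * outcomeWeight p n (Finset.univ : Finset (Fin n)) := by
  simp_rw [allPark_iff]
  exact parkingMeasure_real_apply n p
    (fun v => parkCars ∅ (List.ofFn v) = some (Finset.univ : Finset (Fin n)))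

theorem Q_eq_div (m : ℕ) (p : unitInterval) (j : Fin (m + 1)) :
    Q (m + 1) p j = lastPrefWeight p m Finset.univ j /
      outcomeWeight p (m + 1) (Finset.univ : Finset (Fin (m + 1))) := by
  unfold Q
  rw [measureReal_def, cond_apply (Set.toFinite _).measurableSet, ENNReal.toReal_mul,
    ENNReal.toReal_inv, ← measureReal_def, ← measureReal_def, parkingMeasure_real_allPark]
  have h : ({ω | AllPark ω.1 ω.2} ∩ {ω | ω.1 (lastCar (m + 1)) = j} :
      Set ((Fin (m + 1) → Fin (m + 1)) × (Fin (m + 1) → Bool))) =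
      {ω | parkCars ∅ (List.ofFn fun i => (ω.1 i, ω.2 i)) = some Finset.univ ∧
        ω.1 (Fin.last m) = j} := by
    ext ω
    simp only [Set.mem_inter_iff, Set.mem_ofPred_eq, allPark_iff]
    rfl
  rw [h]
  have h2 := parkingMeasure_real_apply (m + 1) p (fun v => parkCars ∅ (List.ofFn v) =
    some (Finset.univ : Finset (Fin (m + 1))) ∧ (v (Fin.last m)).1 = j)
  rw [h2]
  change _ * (_ * lastPrefWeight (p : ℝ) m Finset.univ j) = _
  have h3 : (((m + 1 : ℕ) : ℝ) ^ (m + 1)) ≠ 0 := by positivity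
  rw [mul_inv, inv_inv]
  field_simp

/-- The ratio of `(a / e) ^ a` to `a!`. -/
noncomputable def stirlingRatio (a : ℕ) : ℝ := (a / Real.exp 1) ^ a / a.factorial

theorem stirlingRatio_mul_exp (a : ℕ) :
    stirlingRatio a * Real.exp a * a.factorial = (a : ℝ) ^ a := by
  have h : (a.factorial : ℝ) ≠ 0 := by positivity
  have h2 := (Real.exp_pos 1).ne'
  rw [stirlingRatio, ← Real.exp_one_pow a, div_pow]
  field_simp

theorem stirlingRatio_nonneg (a : ℕ) : 0 ≤ stirlingRatio a := by
  unfold stirlingRatio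
  positivity

theorem stirlingRatio_mul_sqrt_le {a : ℕ} : stirlingRatio a * √a ≤ 1 := by
  have h := Stirling.le_factorial_stirling a
  have h2 : √(a : ℝ) ≤ √(2 * Real.pi * a) :=
    Real.sqrt_le_sqrt (by nlinarith [Real.pi_gt_three, (Nat.cast_nonneg a : (0 : ℝ) ≤ a)])
  rw [stirlingRatio, div_mul_eq_mul_div, div_le_one (by positivity), mul_comm]
  exact le_trans (by gcongr) h

theorem le_stirlingRatio_mul_sqrt {a : ℕ} (ha : 1 ≤ a) :
    1 ≤ stirlingRatio a * (Real.exp 1 * √a) := by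
  obtain ⟨b, rfl⟩ := Nat.exists_eq_add_of_le' ha
  have h : Stirling.stirlingSeq (b + 1) ≤ Stirling.stirlingSeq (0 + 1) :=
    Stirling.stirlingSeq'_antitone (Nat.zero_le b)
  rw [zero_add, Stirling.stirlingSeq_one, Stirling.stirlingSeq, div_le_div_iff₀ (by positivity)
    (by positivity), Real.sqrt_mul (by norm_num)] at h
  rw [stirlingRatio, div_mul_eq_mul_div, le_div_iff₀ (by positivity), one_mul]
  have h2 : (0 : ℝ) < √2 := by positivity
  refine le_of_mul_le_mul_right (h.trans (le_of_eq ?_)) h2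
  ring

theorem sum_one_div_sqrt_le (m : ℕ) :
    ∑ k ∈ Finset.range m, 1 / √((k : ℝ) + 1) ≤ 2 * √m := by
  induction m with
  | zero => simp
  | succ m ih =>
    rw [Finset.sum_range_succ]
    have h1 : 0 < √((m : ℝ) + 1) := by positivity
    have h2 : √((m : ℝ) + 1) ^ 2 = m + 1 := Real.sq_sqrt (by positivity)
    have h3 : √(m : ℝ) ^ 2 = m := Real.sq_sqrt (by positivity)
    have h4 : 1 / √((m : ℝ) + 1) ≤ 2 * (√((m : ℝ) + 1) - √m) := by
      rw [div_le_iff₀ h1]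
      nlinarith [sq_nonneg (√((m : ℝ) + 1) - √m)]
    push_cast
    linarith

theorem one_div_sqrt_mul_sqrt_le {a b : ℝ} (ha : 0 < a) (hb : 0 < b) :
    1 / (√a * √b) ≤ (1 / √a + 1 / √b) / √(a + b) := by
  have h1 : 0 < √a := by positivity
  have h2 : 0 < √b := by positivity
  have h3 : 0 < √(a + b) := by positivity
  rw [div_add_div _ _ h1.ne' h2.ne', div_div, div_le_div_iff₀ (by positivity) (by positivity)]
  have h4 : √(a + b) ≤ √a + √b := by
    rw [Real.sqrt_le_left (by positivity)]
    nlinarith [Real.sq_sqrt ha.le, Real.sq_sqrt hb.le, mul_pos h1 h2]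
  nlinarith [mul_le_mul_of_nonneg_left h4 (mul_pos h1 h2).le]

theorem sum_one_div_sqrt_mul_sqrt_le (m : ℕ) :
    ∑ k ∈ Finset.range (m + 1), 1 / (√((k : ℝ) + 1) * √(((m - k : ℕ) : ℝ) + 1)) ≤ 4 := by
  have h0 : 0 < √((m : ℝ) + 2) := by positivity
  have h1 : ∑ k ∈ Finset.range (m + 1), 1 / (√((k : ℝ) + 1) * √(((m - k : ℕ) : ℝ) + 1)) ≤
      ∑ k ∈ Finset.range (m + 1),
        (1 / √((k : ℝ) + 1) + 1 / √(((m - k : ℕ) : ℝ) + 1)) / √((m : ℝ) + 2) := by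
    refine Finset.sum_le_sum fun k hk => ?_
    have hkm : k ≤ m := by simpa [Nat.lt_succ_iff] using hk
    have h := one_div_sqrt_mul_sqrt_le (a := (k : ℝ) + 1) (b := ((m - k : ℕ) : ℝ) + 1)
      (by positivity) (by positivity)
    rwa [show (k : ℝ) + 1 + (((m - k : ℕ) : ℝ) + 1) = m + 2 by
      rw [Nat.cast_sub hkm]; ring] at h
  refine h1.trans ?_
  rw [← Finset.sum_div, Finset.sum_add_distrib, div_le_iff₀ h0]
  have h2 := Finset.sum_range_reflect (fun k : ℕ => 1 / √((k : ℝ) + 1)) (m + 1)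
  simp only [Nat.add_sub_cancel] at h2
  rw [h2]
  have h3 := sum_one_div_sqrt_le (m + 1)
  have h4 : √((m + 1 : ℕ) : ℝ) ≤ √((m : ℝ) + 2) := Real.sqrt_le_sqrt (by push_cast; linarith)
  linarith

/-- The probability that the `m` first of `m + 1` cars leave the spot with `k` spots before it
empty, given that they park. -/
noncomputable def gapProb (m k : ℕ) : ℝ := gapWeight m k / (2 * ((m : ℝ) + 2) ^ m / (m + 2))

theorem gapWeight_nonneg (m k : ℕ) : 0 ≤ gapWeight m k := by
  unfold gapWeight parkingCount
  positivity

theorem gapProb_nonneg (m k : ℕ) : 0 ≤ gapProb m k :=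
  div_nonneg (gapWeight_nonneg m k) (by positivity)

theorem gapProb_reflect {m k : ℕ} (hk : k ≤ m) : gapProb m (m - k) = gapProb m k := by
  rw [gapProb, gapProb, gapWeight_reflect hk]

theorem sum_gapProb (m : ℕ) : ∑ k ∈ Finset.range (m + 1), gapProb m k = 1 := by
  unfold gapProb
  rw [← Finset.sum_div, ← sum_gapWeight m, mul_div_cancel_left₀ _ (by positivity)]
  have h : ((m : ℝ) + 2) * ∑ k ∈ Finset.range (m + 1), gapWeight m k ≠ 0 := by
    rw [sum_gapWeight]
    positivity
  exact div_self (right_ne_zero_of_mul h)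

theorem mul_parkingCount_eq (k : ℕ) :
    ((k : ℝ) + 1) * parkingCount k =
      stirlingRatio (k + 1) * Real.exp (k + 1) * k.factorial := by
  have h1 := stirlingRatio_mul_exp (k + 1)
  have h2 : ((k : ℝ) + 1) * parkingCount k = ((k : ℝ) + 1) ^ k := by
    unfold parkingCount
    rcases k with _ | k
    · simp
    · rw [Nat.add_sub_cancel, ← pow_succ']
  rw [h2]
  rw [Nat.factorial_succ, pow_succ] at h1
  push_cast at h1
  have h3 : ((k : ℝ) + 1) ≠ 0 := by positivity
  refine mul_right_cancel₀ h3 ?_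
  linear_combination -h1

theorem gapProb_mul_eq {m k : ℕ} (hk : k ≤ m) :
    gapProb m k * (((k : ℝ) + 1) * ((m - k : ℕ) + 1)) * (2 * (m + 1) * stirlingRatio (m + 2)) =
      ((m : ℝ) + 2) ^ 2 * (stirlingRatio (k + 1) * stirlingRatio (m - k + 1)) := by
  have h1 := mul_parkingCount_eq k
  have h2 := mul_parkingCount_eq (m - k)
  have h3 := stirlingRatio_mul_exp (m + 2)
  have h4 : (m.choose k : ℝ) * k.factorial * (m - k).factorial = m.factorial := by
    exact_mod_cast Nat.choose_mul_factorial_mul_factorial hk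
  have h5 : ((m + 2).factorial : ℝ) = (m + 2) * ((m + 1) * m.factorial) := by
    rw [Nat.factorial_succ, Nat.factorial_succ]
    push_cast
    ring
  have h6 : Real.exp ((k : ℝ) + 1) * Real.exp ((m - k : ℕ) + 1) = Real.exp (m + 2 : ℕ) := by
    rw [← Real.exp_add]
    congr 1
    rw [Nat.cast_sub hk]
    push_cast
    ring
  have h7 : gapWeight m k * (((k : ℝ) + 1) * ((m - k : ℕ) + 1)) =
      stirlingRatio (k + 1) * stirlingRatio (m - k + 1) * Real.exp (m + 2 : ℕ) * m.factorial := by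
    unfold gapWeight
    calc _ = (m.choose k : ℝ) * (((k : ℝ) + 1) * parkingCount k) *
          (((m - k : ℕ) + 1) * parkingCount (m - k)) := by ring
      _ = stirlingRatio (k + 1) * stirlingRatio (m - k + 1) *
          (Real.exp ((k : ℝ) + 1) * Real.exp ((m - k : ℕ) + 1)) *
          ((m.choose k : ℝ) * k.factorial * (m - k).factorial) := by
        rw [h1, h2]
        ring
      _ = _ := by rw [h6, h4]
  have h8 : ((m : ℝ) + 2) ^ m ≠ 0 := by positivity
  have h9 : ((m : ℝ) + 2) ≠ 0 := by positivity
  rw [gapProb, div_mul_eq_mul_div, h7, div_mul_eq_mul_div, div_eq_iff (by positivity)]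
  rw [h5] at h3
  push_cast at h3 ⊢
  field_simp
  rw [pow_add] at h3
  have h10 : stirlingRatio (m + 2) * Real.exp (m + 2) * ((m + 1) * m.factorial) =
      ((m : ℝ) + 2) ^ m * (m + 2) := mul_right_cancel₀ h9 (by linear_combination h3)
  linear_combination (stirlingRatio (k + 1) * stirlingRatio (m - k + 1)) * h10

/-- The mean of `(k + 1) * (m - k + 1)` under `gapProb m`. -/
noncomputable def meanGapProduct (m : ℕ) : ℝ :=
  ∑ k ∈ Finset.range (m + 1), gapProb m k * (((k : ℝ) + 1) * ((m - k : ℕ) + 1))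

theorem meanGapProduct_mul_eq (m : ℕ) :
    meanGapProduct m * (2 * (m + 1) * stirlingRatio (m + 2)) = ((m : ℝ) + 2) ^ 2 *
      ∑ k ∈ Finset.range (m + 1), stirlingRatio (k + 1) * stirlingRatio (m - k + 1) := by
  rw [meanGapProduct, Finset.sum_mul, Finset.mul_sum]
  refine Finset.sum_congr rfl fun k hk => gapProb_mul_eq ?_
  simpa [Nat.lt_succ_iff] using hk

theorem meanGapProduct_nonneg (m : ℕ) : 0 ≤ meanGapProduct m :=
  Finset.sum_nonneg fun k _ => mul_nonneg (gapProb_nonneg m k) (by positivity)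

theorem stirlingRatio_succ_le (k : ℕ) : stirlingRatio (k + 1) ≤ 1 / √((k : ℝ) + 1) := by
  rw [le_div_iff₀ (by positivity)]
  exact_mod_cast stirlingRatio_mul_sqrt_le (a := k + 1)

theorem le_stirlingRatio_succ (k : ℕ) :
    1 / √((k : ℝ) + 1) ≤ Real.exp 1 * stirlingRatio (k + 1) := by
  rw [div_le_iff₀ (by positivity)]
  have := le_stirlingRatio_mul_sqrt (a := k + 1) (by omega)
  push_cast at this
  linarith

theorem meanGapProduct_le (m : ℕ) :
    meanGapProduct m ≤ 4 * Real.exp 1 * ((m + 2) * √((m : ℝ) + 2)) := by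
  have h1 : ∑ k ∈ Finset.range (m + 1), stirlingRatio (k + 1) * stirlingRatio (m - k + 1) ≤ 4 := by
    refine le_trans (Finset.sum_le_sum fun k _ => ?_) (sum_one_div_sqrt_mul_sqrt_le m)
    rw [← one_div_mul_one_div]
    exact mul_le_mul (stirlingRatio_succ_le k) (stirlingRatio_succ_le (m - k))
      (stirlingRatio_nonneg _) (by positivity)
  have h2 := meanGapProduct_mul_eq m
  have h3 := le_stirlingRatio_mul_sqrt (a := m + 2) (by omega)
  push_cast at h3
  have h4 := meanGapProduct_nonneg m
  set E := meanGapProduct m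
  set r := stirlingRatio (m + 2)
  set s := √((m : ℝ) + 2)
  have hs : 0 < s := by positivity
  have he := Real.exp_pos 1
  have h5 : E * (2 * (m + 1) * r) ≤ ((m : ℝ) + 2) ^ 2 * 4 := by
    rw [h2]
    gcongr
  have h6 : E * ((m : ℝ) + 2) ≤ 4 * Real.exp 1 * ((m + 2) * s) * (m + 2) := by
    calc E * ((m : ℝ) + 2) ≤ E * (2 * (m + 1)) :=
          mul_le_mul_of_nonneg_left (by linarith [(Nat.cast_nonneg m : (0 : ℝ) ≤ m)]) h4
      _ ≤ E * (2 * (m + 1)) * (r * (Real.exp 1 * s)) :=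
          le_mul_of_one_le_right (by positivity) h3
      _ = E * (2 * (m + 1) * r) * (Real.exp 1 * s) := by ring
      _ ≤ ((m : ℝ) + 2) ^ 2 * 4 * (Real.exp 1 * s) := by gcongr
      _ = _ := by ring
  exact le_of_mul_le_mul_right h6 (by positivity)

theorem le_meanGapProduct (m : ℕ) :
    ((m + 2) * √((m : ℝ) + 2)) ≤ 2 * Real.exp 1 ^ 2 * meanGapProduct m := by
  have h1 : 1 ≤ Real.exp 1 ^ 2 *
      ∑ k ∈ Finset.range (m + 1), stirlingRatio (k + 1) * stirlingRatio (m - k + 1) := by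
    have h : ∑ k ∈ Finset.range (m + 1), (1 / ((m : ℝ) + 1)) ≤ Real.exp 1 ^ 2 *
      ∑ k ∈ Finset.range (m + 1), stirlingRatio (k + 1) * stirlingRatio (m - k + 1) := by
      rw [Finset.mul_sum]
      refine Finset.sum_le_sum fun k hk => ?_
      have hkm : k ≤ m := by simpa [Nat.lt_succ_iff] using hk
      have h2 := mul_le_mul (le_stirlingRatio_succ k) (le_stirlingRatio_succ (m - k))
        (by positivity) (mul_nonneg (Real.exp_pos 1).le (stirlingRatio_nonneg _))
      have h3 : √((k : ℝ) + 1) * √(((m - k : ℕ) : ℝ) + 1) ≤ m + 1 := by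
        rw [← Real.sqrt_mul (by positivity), Real.sqrt_le_left (by positivity), Nat.cast_sub hkm]
        have h4 : (k : ℝ) ≤ m := by exact_mod_cast hkm
        have h5 : (0 : ℝ) ≤ k := by positivity
        rw [sq]
        exact mul_le_mul (by linarith) (by linarith) (by linarith) (by linarith)
      calc 1 / ((m : ℝ) + 1) ≤ 1 / (√((k : ℝ) + 1) * √(((m - k : ℕ) : ℝ) + 1)) :=
            one_div_le_one_div_of_le (by positivity) h3
        _ = _ := (one_div_mul_one_div _ _).symm
        _ ≤ _ := h2
        _ = _ := by ring
    refine le_trans (le_of_eq ?_) h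
    rw [Finset.sum_const, Finset.card_range, nsmul_eq_mul]
    push_cast
    field_simp
  have h2 := meanGapProduct_mul_eq m
  have h3 := stirlingRatio_mul_sqrt_le (a := m + 2)
  push_cast at h3
  have h4 := meanGapProduct_nonneg m
  set E := meanGapProduct m
  set r := stirlingRatio (m + 2)
  set s := √((m : ℝ) + 2)
  set S := ∑ k ∈ Finset.range (m + 1), stirlingRatio (k + 1) * stirlingRatio (m - k + 1)
  have hs : 0 < s := by positivity
  have h6 : ((m + 2) * s) * ((m : ℝ) + 2) ≤ 2 * Real.exp 1 ^ 2 * E * (m + 2) := by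
    calc ((m + 2) * s) * ((m : ℝ) + 2) ≤ ((m + 2) * s) * ((m : ℝ) + 2) * (Real.exp 1 ^ 2 * S) :=
          le_mul_of_one_le_right (by positivity) h1
      _ = (Real.exp 1 ^ 2 * s) * (((m : ℝ) + 2) ^ 2 * S) := by ring
      _ = 2 * Real.exp 1 ^ 2 * E * (m + 1) * (r * s) := by rw [← h2]; ring
      _ ≤ 2 * Real.exp 1 ^ 2 * E * (m + 1) := mul_le_of_le_one_right (by positivity) h3
      _ ≤ _ := by gcongr; norm_num
  exact le_of_mul_le_mul_right h6 (by positivity)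

/-- The sign of `k - j`. -/
noncomputable def side (j k : ℕ) : ℝ := if j < k then 1 else if k < j then -1 else 0

/-- The average of `side j k` over a gap `k` and its mirror image `m - k`. -/
noncomputable def symmSide (m j k : ℕ) : ℝ := (side j k + side j (m - k)) / 2

theorem sum_gapProb_reflect (m : ℕ) (f : ℕ → ℝ) :
    ∑ k ∈ Finset.range (m + 1), gapProb m k * f (m - k) =
      ∑ k ∈ Finset.range (m + 1), gapProb m k * f k := by
  rw [← Finset.sum_range_reflect (fun k => gapProb m k * f k) (m + 1)]
  refine Finset.sum_congr rfl fun k hk => ?_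
  have hkm : k ≤ m := by simpa [Nat.lt_succ_iff] using hk
  rw [Nat.add_sub_cancel, gapProb_reflect hkm]

theorem Q_eq_sum_gapProb (m : ℕ) (p : unitInterval) (j : Fin (m + 1)) :
    Q (m + 1) p j * (m + 2) = 2 * ∑ k ∈ Finset.range (m + 1), gapProb m k *
      (if (j : ℕ) = k then 1 else if (j : ℕ) < k then (p : ℝ) else 1 - p) := by
  rw [Q_eq_div, lastPrefWeight_univ, outcomeWeight_univ, parkingCount, Nat.add_sub_cancel,
    div_mul_eq_mul_div, Finset.sum_mul, Finset.sum_div, Finset.mul_sum]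
  refine Finset.sum_congr rfl fun k _ => ?_
  rw [gapProb]
  have h : ((m : ℝ) + 2) ≠ 0 := by positivity
  push_cast
  rw [show (m : ℝ) + 1 + 1 = m + 2 by ring]
  field_simp

theorem Q_eq_symmSide (m : ℕ) (p : unitInterval) (j : Fin (m + 1)) :
    Q (m + 1) p j * (m + 2) = 1 + gapProb m j +
      (2 * p - 1) * ∑ k ∈ Finset.range (m + 1), gapProb m k * symmSide m j k := by
  have h1 : ∀ k : ℕ, (if (j : ℕ) = k then 1 else if (j : ℕ) < k then (p : ℝ) else 1 - p) =
      1 / 2 + (if (j : ℕ) = k then 1 / 2 else 0) + (p - 1 / 2) * side j k := by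
    intro k
    unfold side
    rcases lt_trichotomy (j : ℕ) k with h | h | h
    · simp [h, h.ne]
    · simp [h]
      norm_num
    · simp [h, h.ne', h.not_gt]
      norm_num
      ring
  have h2 : ∑ k ∈ Finset.range (m + 1), gapProb m k * symmSide m j k =
      ∑ k ∈ Finset.range (m + 1), gapProb m k * side j k := by
    have := sum_gapProb_reflect m (side j)
    have h3 : ∑ k ∈ Finset.range (m + 1), gapProb m k * symmSide m j k =
        (∑ k ∈ Finset.range (m + 1), gapProb m k * side j k +
          ∑ k ∈ Finset.range (m + 1), gapProb m k * side j (m - k)) / 2 := by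
      rw [← Finset.sum_add_distrib, Finset.sum_div]
      exact Finset.sum_congr rfl fun k _ => by unfold symmSide; ring
    rw [h3, this]
    ring
  rw [Q_eq_sum_gapProb, h2]
  simp_rw [h1, mul_add, Finset.sum_add_distrib, ← Finset.sum_mul]
  rw [sum_gapProb]
  have h3 : ∑ k ∈ Finset.range (m + 1), gapProb m k * (if (j : ℕ) = k then 1 / 2 else 0) =
      gapProb m j / 2 := by
    rw [Finset.sum_eq_single_of_mem (j : ℕ) (Finset.mem_range.2 j.2)]
    · simp
      ring
    · intro k _ hk
      simp [hk.symm]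
  have h4 : ∑ k ∈ Finset.range (m + 1), gapProb m k * (((p : ℝ) - 1 / 2) * side j k) =
      (p - 1 / 2) * ∑ k ∈ Finset.range (m + 1), gapProb m k * side j k := by
    rw [Finset.mul_sum]
    exact Finset.sum_congr rfl fun k _ => by ring
  rw [h3, h4]
  ring

/-- The total bias of the gap away from the spots. -/
noncomputable def gapBias (m : ℕ) : ℝ :=
  ∑ j ∈ Finset.range (m + 1), |∑ k ∈ Finset.range (m + 1), gapProb m k * symmSide m j k|

theorem abs_tvDist_sub_gapBias_le (m : ℕ) (p : unitInterval) :
    |2 * (tvDist (Q (m + 1) p) (unif (m + 1)) * (m + 2)) - |2 * (p : ℝ) - 1| * gapBias m| ≤ 2 := by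
  have h0 : (0 : ℝ) < (m : ℝ) + 2 := by positivity
  have h1 : 2 * (tvDist (Q (m + 1) p) (unif (m + 1)) * (m + 2)) =
      ∑ j : Fin (m + 1), |(Q (m + 1) p j - unif (m + 1) j) * (m + 2)| := by
    simp_rw [abs_mul, abs_of_pos h0, ← Finset.sum_mul]
    unfold tvDist
    ring
  have h2 : |2 * (p : ℝ) - 1| * gapBias m = ∑ j : Fin (m + 1),
      |(2 * (p : ℝ) - 1) * ∑ k ∈ Finset.range (m + 1), gapProb m k * symmSide m j k| := by
    simp_rw [abs_mul, ← Finset.mul_sum]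
    rw [gapBias, Finset.sum_range]
  rw [h1, h2, ← Finset.sum_sub_distrib]
  refine (Finset.abs_sum_le_sum_abs _ _).trans ?_
  have h3 : ∑ j : Fin (m + 1), (gapProb m j + 1 / ((m : ℝ) + 1)) = 2 := by
    rw [Finset.sum_add_distrib, Fin.sum_univ_eq_sum_range (gapProb m), sum_gapProb]
    rw [Finset.sum_const, Finset.card_univ, Fintype.card_fin, nsmul_eq_mul]
    push_cast
    field_simp
    norm_num
  refine le_trans (Finset.sum_le_sum fun j _ => ?_) h3.le
  refine (abs_abs_sub_abs_le _ _).trans ?_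
  rw [sub_mul, Q_eq_symmSide, unif]
  have h4 : 1 / ((m + 1 : ℕ) : ℝ) * (m + 2) = 1 + 1 / ((m : ℝ) + 1) := by
    push_cast
    field_simp
    ring
  rw [h4, abs_le]
  have h5 := gapProb_nonneg m j
  have h6 : 0 ≤ 1 / ((m : ℝ) + 1) := by positivity
  constructor <;> linarith

theorem symmSide_nonneg {m j k : ℕ} (hk : k ≤ m) (hj : 2 * j ≤ m) : 0 ≤ symmSide m j k := by
  unfold symmSide side
  split_ifs <;> first | omega | norm_num

theorem symmSide_nonpos {m j k : ℕ} (hk : k ≤ m) (hj : m ≤ 2 * j) : symmSide m j k ≤ 0 := by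
  unfold symmSide side
  split_ifs <;> first | omega | norm_num

theorem gapBias_eq (m : ℕ) : gapBias m = ∑ k ∈ Finset.range (m + 1),
    gapProb m k * ∑ j ∈ Finset.range (m + 1), |symmSide m j k| := by
  unfold gapBias
  simp_rw [Finset.mul_sum]
  rw [Finset.sum_comm (s := Finset.range (m + 1)) (t := Finset.range (m + 1))
    (f := fun k j => gapProb m k * |symmSide m j k|)]
  refine Finset.sum_congr rfl fun j _ => ?_
  rcases le_total (2 * j) m with hj | hj
  · have h : ∀ k ∈ Finset.range (m + 1), 0 ≤ symmSide m j k := fun k hk =>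
      symmSide_nonneg (by simpa [Nat.lt_succ_iff] using hk) hj
    rw [abs_of_nonneg (Finset.sum_nonneg fun k hk => mul_nonneg (gapProb_nonneg m k) (h k hk))]
    exact Finset.sum_congr rfl fun k hk => by rw [abs_of_nonneg (h k hk)]
  · have h : ∀ k ∈ Finset.range (m + 1), symmSide m j k ≤ 0 := fun k hk =>
      symmSide_nonpos (by simpa [Nat.lt_succ_iff] using hk) hj
    rw [abs_of_nonpos (Finset.sum_nonpos fun k hk =>
      mul_nonpos_of_nonneg_of_nonpos (gapProb_nonneg m k) (h k hk)), ← Finset.sum_neg_distrib]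
    exact Finset.sum_congr rfl fun k hk => by rw [abs_of_nonpos (h k hk), mul_neg]

theorem sum_range_ite_lt_one {m c : ℕ} (hc : c ≤ m) :
    ∑ j ∈ Finset.range m, (if j < c then (1 : ℝ) else 0) = c := by
  rw [← Finset.sum_filter]
  have : Finset.filter (fun j => j < c) (Finset.range m) = Finset.range c := by
    ext j
    simp only [Finset.mem_filter, Finset.mem_range]
    omega
  simp [this]

theorem sum_range_ite_reflect_lt_one {m c : ℕ} (hc : c ≤ m + 1) :
    ∑ j ∈ Finset.range (m + 1), (if m - j < c then (1 : ℝ) else 0) = c := by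
  have h := Finset.sum_range_reflect (fun j => if j < c then (1 : ℝ) else 0) (m + 1)
  rw [sum_range_ite_lt_one hc] at h
  simpa only [Nat.add_sub_cancel] using h

theorem sum_abs_symmSide_le {m k : ℕ} (hk : k ≤ m) :
    ∑ j ∈ Finset.range (m + 1), |symmSide m j k| ≤ 2 * ((min k (m - k) : ℕ) + 1) := by
  have h1 := sum_range_ite_lt_one (m := m + 1) (c := min k (m - k) + 1) (by omega)
  have h2 := sum_range_ite_reflect_lt_one (m := m) (c := min k (m - k) + 1) (by omega)
  have h3 : ∑ j ∈ Finset.range (m + 1), |symmSide m j k| ≤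
      ∑ j ∈ Finset.range (m + 1), ((if j < min k (m - k) + 1 then (1 : ℝ) else 0) +
        (if m - j < min k (m - k) + 1 then (1 : ℝ) else 0)) := by
    refine Finset.sum_le_sum fun j hj => ?_
    rw [Finset.mem_range] at hj
    unfold symmSide side
    split_ifs <;> first | omega | (rw [abs_le]; constructor <;> norm_num)
  rw [Finset.sum_add_distrib, h1, h2] at h3
  push_cast at h3 ⊢
  linarith

theorem le_sum_abs_symmSide {m k : ℕ} (hk : k ≤ m) :
    2 * ((min k (m - k) : ℕ) : ℝ) ≤ ∑ j ∈ Finset.range (m + 1), |symmSide m j k| := by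
  have h1 := sum_range_ite_lt_one (m := m + 1) (c := min k (m - k)) (by omega)
  have h2 := sum_range_ite_reflect_lt_one (m := m) (c := min k (m - k)) (by omega)
  have h3 : ∑ j ∈ Finset.range (m + 1), ((if j < min k (m - k) then (1 : ℝ) else 0) +
        (if m - j < min k (m - k) then (1 : ℝ) else 0)) ≤
      ∑ j ∈ Finset.range (m + 1), |symmSide m j k| := by
    refine Finset.sum_le_sum fun j hj => ?_
    rw [Finset.mem_range] at hj
    unfold symmSide side
    split_ifs <;> first | omega | norm_num
  rw [Finset.sum_add_distrib, h1, h2] at h3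
  linarith

theorem min_add_one_mul_le {m k : ℕ} (hk : k ≤ m) :
    (((min k (m - k) : ℕ) : ℝ) + 1) * (m + 2) ≤ 2 * (((k : ℝ) + 1) * ((m - k : ℕ) + 1)) := by
  obtain ⟨d, rfl⟩ := Nat.exists_eq_add_of_le hk
  rw [Nat.add_sub_cancel_left]
  norm_cast
  rcases le_total k d with h | h
  · rw [min_eq_left h]
    nlinarith
  · rw [min_eq_right h]
    nlinarith

theorem le_min_add_one_mul {m k : ℕ} (hk : k ≤ m) :
    (((k : ℝ) + 1) * ((m - k : ℕ) + 1)) ≤ (((min k (m - k) : ℕ) : ℝ) + 1) * (m + 2) := by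
  obtain ⟨d, rfl⟩ := Nat.exists_eq_add_of_le hk
  rw [Nat.add_sub_cancel_left]
  norm_cast
  rcases le_total k d with h | h
  · rw [min_eq_left h]
    nlinarith
  · rw [min_eq_right h]
    nlinarith

theorem gapBias_mul_le (m : ℕ) : gapBias m * (m + 2) ≤ 4 * meanGapProduct m := by
  rw [gapBias_eq, meanGapProduct, Finset.sum_mul, Finset.mul_sum]
  refine Finset.sum_le_sum fun k hk => ?_
  have hkm : k ≤ m := by simpa [Nat.lt_succ_iff] using hk
  have h1 := mul_le_mul_of_nonneg_right (sum_abs_symmSide_le hkm)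
    (by positivity : (0 : ℝ) ≤ (m : ℝ) + 2)
  have h2 := min_add_one_mul_le hkm
  have h3 := mul_le_mul_of_nonneg_left
    (by linarith : (∑ j ∈ Finset.range (m + 1), |symmSide m j k|) * ((m : ℝ) + 2) ≤
      4 * (((k : ℝ) + 1) * ((m - k : ℕ) + 1))) (gapProb_nonneg m k)
  linarith

theorem le_gapBias_mul (m : ℕ) : 2 * meanGapProduct m ≤ (gapBias m + 2) * (m + 2) := by
  have h0 : gapBias m + 2 = ∑ k ∈ Finset.range (m + 1),
      gapProb m k * (∑ j ∈ Finset.range (m + 1), |symmSide m j k| + 2) := by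
    simp_rw [mul_add, Finset.sum_add_distrib, ← Finset.sum_mul]
    rw [sum_gapProb, gapBias_eq, one_mul]
  rw [h0, meanGapProduct, Finset.sum_mul, Finset.mul_sum]
  refine Finset.sum_le_sum fun k hk => ?_
  have hkm : k ≤ m := by simpa [Nat.lt_succ_iff] using hk
  have h1 := mul_le_mul_of_nonneg_right (le_sum_abs_symmSide hkm)
    (by positivity : (0 : ℝ) ≤ (m : ℝ) + 2)
  have h2 := le_min_add_one_mul hkm
  have h3 := mul_le_mul_of_nonneg_left
    (by linarith : 2 * (((k : ℝ) + 1) * ((m - k : ℕ) + 1)) ≤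
      (∑ j ∈ Finset.range (m + 1), |symmSide m j k| + 2) * ((m : ℝ) + 2)) (gapProb_nonneg m k)
  linarith

theorem gapBias_le (m : ℕ) : gapBias m ≤ 16 * Real.exp 1 * √((m : ℝ) + 2) := by
  have h1 := gapBias_mul_le m
  have h2 := meanGapProduct_le m
  refine le_of_mul_le_mul_right (a := (m : ℝ) + 2) ?_ (by positivity)
  linarith

theorem le_gapBias (m : ℕ) : √((m : ℝ) + 2) ≤ Real.exp 1 ^ 2 * (gapBias m + 2) := by
  have h1 := mul_le_mul_of_nonneg_left (le_gapBias_mul m) (sq_nonneg (Real.exp 1))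
  have h2 := le_meanGapProduct m
  refine le_of_mul_le_mul_right (a := (m : ℝ) + 2) ?_ (by positivity)
  linarith

theorem gapBias_nonneg (m : ℕ) : 0 ≤ gapBias m := Finset.sum_nonneg fun _ _ => abs_nonneg _

theorem tvDist_nonneg {n : ℕ} (P R : Fin n → ℝ) : 0 ≤ tvDist P R :=
  mul_nonneg (by norm_num) (Finset.sum_nonneg fun _ _ => abs_nonneg _)

theorem tvDist_mul_sqrt_le (m : ℕ) (p : unitInterval) :
    tvDist (Q (m + 1) p) (unif (m + 1)) * √((m : ℝ) + 1) ≤ 8 * Real.exp 1 + 1 := by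
  have h1 := (abs_le.1 (abs_tvDist_sub_gapBias_le m p)).2
  have h2 := gapBias_le m
  have h3 : |2 * (p : ℝ) - 1| ≤ 1 := abs_le.2 ⟨by linarith [p.2.1], by linarith [p.2.2]⟩
  have h4 := mul_le_of_le_one_left (gapBias_nonneg m) h3
  have h5 : √((m : ℝ) + 1) ≤ √((m : ℝ) + 2) := Real.sqrt_le_sqrt (by linarith)
  have h6 : √((m : ℝ) + 2) * √((m : ℝ) + 2) = m + 2 := Real.mul_self_sqrt (by positivity)
  have h7 : 1 ≤ √((m : ℝ) + 2) := Real.one_le_sqrt.2 (by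
    linarith [(Nat.cast_nonneg m : (0 : ℝ) ≤ m)])
  have h8 := tvDist_nonneg (Q (m + 1) p) (unif (m + 1))
  refine (mul_le_mul_of_nonneg_left h5 h8).trans ?_
  refine le_of_mul_le_mul_right (a := √((m : ℝ) + 2)) ?_ (by positivity)
  rw [mul_assoc, h6]
  linarith

theorem le_tvDist_mul_sqrt (m : ℕ) (p : unitInterval) (hp : (p : ℝ) ≠ 1 / 2)
    (hm : 8 * Real.exp 1 ^ 2 / |2 * (p : ℝ) - 1| ≤ √((m : ℝ) + 2)) :
    |2 * (p : ℝ) - 1| / (8 * Real.exp 1 ^ 2) ≤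
      tvDist (Q (m + 1) p) (unif (m + 1)) * √((m : ℝ) + 1) := by
  have h1 := (abs_le.1 (abs_tvDist_sub_gapBias_le m p)).1
  have h2 := le_gapBias m
  have h3 : |2 * (p : ℝ) - 1| ≤ 1 := abs_le.2 ⟨by linarith [p.2.1], by linarith [p.2.2]⟩
  have h4 : 0 < |2 * (p : ℝ) - 1| := abs_pos.2 fun h => hp (by linarith)
  have h5 : √((m : ℝ) + 2) ≤ 2 * √((m : ℝ) + 1) := by
    rw [Real.sqrt_le_left (by positivity), mul_pow, Real.sq_sqrt (by positivity)]
    linarith [(Nat.cast_nonneg m : (0 : ℝ) ≤ m)]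
  have h6 : √((m : ℝ) + 2) * √((m : ℝ) + 2) = m + 2 := Real.mul_self_sqrt (by positivity)
  have h8 := tvDist_nonneg (Q (m + 1) p) (unif (m + 1))
  have he : 0 < Real.exp 1 ^ 2 := by positivity
  rw [div_le_iff₀ h4] at hm
  set T := tvDist (Q (m + 1) p) (unif (m + 1))
  set d := |2 * (p : ℝ) - 1|
  set s := √((m : ℝ) + 2)
  have hs : 0 < s := by positivity
  have h9 : d * s ≤ Real.exp 1 ^ 2 * (2 * (T * (m + 2)) + 4) := by
    calc d * s ≤ d * (Real.exp 1 ^ 2 * (gapBias m + 2)) := by gcongr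
      _ = Real.exp 1 ^ 2 * (d * gapBias m + 2 * d) := by ring
      _ ≤ _ := mul_le_mul_of_nonneg_left (by linarith) he.le
  have h10 : d * s ≤ 4 * Real.exp 1 ^ 2 * (T * s) * s := by
    rw [← h6] at h9
    linarith
  have h11 := le_of_mul_le_mul_right h10 hs
  have h12 := mul_le_mul_of_nonneg_left h5 h8
  rw [div_le_iff₀ (by positivity)]
  have h13 := mul_le_mul_of_nonneg_left h12 he.le
  linarith

end Parking

theorem theorem6 (p : unitInterval) (hp : (p : ℝ) ≠ 1 / 2) :
    (fun n : ℕ+ => Parking.tvDist (Parking.Q (n : ℕ) p) (Parking.unif (n : ℕ)))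
      =Θ[atTop] (fun n : ℕ+ => 1 / Real.sqrt ((n : ℕ) : ℝ)) := by
  have hd : 0 < |2 * (p : ℝ) - 1| := abs_pos.2 fun h => hp (by linarith)
  have key : ∀ n : ℕ+, ∃ m : ℕ, (n : ℕ) = m + 1 ∧
      Parking.tvDist (Parking.Q (n : ℕ) p) (Parking.unif (n : ℕ)) =
        Parking.tvDist (Parking.Q (m + 1) p) (Parking.unif (m + 1)) := by
    rintro ⟨n, hn⟩
    obtain ⟨m, rfl⟩ := Nat.exists_eq_add_of_le' hn
    exact ⟨m, rfl, rfl⟩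
  constructor
  · refine IsBigO.of_bound (8 * Real.exp 1 + 1) (Eventually.of_forall fun n => ?_)
    obtain ⟨m, hm, h⟩ := key n
    have hpos : 0 < √((m : ℝ) + 1) := by positivity
    rw [h, hm, Real.norm_of_nonneg (Parking.tvDist_nonneg _ _), Real.norm_of_nonneg (by positivity),
      mul_one_div]
    push_cast
    rw [le_div_iff₀ hpos]
    exact Parking.tvDist_mul_sqrt_le m p
  · refine IsBigO.of_bound (8 * Real.exp 1 ^ 2 / |2 * (p : ℝ) - 1|) ?_
    have hlim : Tendsto (fun n : ℕ+ => √((n : ℕ) : ℝ)) atTop atTop :=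
      Real.tendsto_sqrt_atTop.comp (tendsto_natCast_atTop_atTop.comp tendsto_PNat_val_atTop_atTop)
    filter_upwards [hlim.eventually_ge_atTop (8 * Real.exp 1 ^ 2 / |2 * (p : ℝ) - 1|)] with n hn
    obtain ⟨m, hm, h⟩ := key n
    have hpos : 0 < √((m : ℝ) + 1) := by positivity
    rw [hm] at hn
    have hle : √((m + 1 : ℕ) : ℝ) ≤ √((m : ℝ) + 2) :=
      Real.sqrt_le_sqrt (by push_cast; linarith)
    have := Parking.le_tvDist_mul_sqrt m p hp (hn.trans hle)
    rw [h, hm, Real.norm_of_nonneg (Parking.tvDist_nonneg _ _), Real.norm_of_nonneg (by positivity)]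
    push_cast
    rw [div_le_iff₀ hpos, mul_assoc]
    rw [div_le_iff₀ (by positivity)] at this
    rw [div_mul_eq_mul_div, le_div_iff₀ hd, one_mul]
    linarith
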